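/- Let $V$ be a finite-dimensional real vector space with a Lorentzian form $\ell$ of signature $(+,-,\dots,-)$, and let $C$ be one of the two closed convex round cones whose union is $\{v\in V:\ell(v,v)\ge 0\}$. Let $\Gamma$ be a group of affine transformations of $V$ whose linear parts preserve $\ell$ and $C$, and which (as a discrete group) acts freely and properly on $V$. Let $M=V/\Gamma$ be the resulting flat complete Lorentzian manifold and $\kappa:V\to M$ the quotient mapping. For $p=\kappa(v)\in M$ let $F_p=\kappa(v+C)$ be the future and $P_p=\kappa(v-C)$ the past of $p$ (they do not depend on the choice of $v$), and let $C_p=d_v\kappa(C)\subset T_pM$. A smooth path $\eta$ in $M$ is called timelike if $\eta'(t)\in C_{\eta(t)}$ for all $t$; $M$ is called causal if it admits no nonconstant closed piecewise smooth timelike path. $M$ is called strictly causal if it is causal and each $p\in M$ has a neighbourhood $U$ such that $U\cap F_p$ and $U\cap P_p$ are closed in $U$. **Proposition.** If $M$ is strictly causal, then its fundamental group $\pi_1(M)$ is virtually abelian, i.e. it has an abelian subgroup of finite index. -/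

import Mathlib

open Set Filter Topology
open scoped ContDiff

section Lorentz

variable {V : Type*} [NormedAddCommGroup V] [NormedSpace ℝ V]

/-- The tautological action of the group of affine automorphisms of `V` on `V`. -/
instance AffineEquiv.instMulActionSelf : MulAction (V ≃ᵃ[ℝ] V) V where
  smul γ v := γ v
  one_smul _ := rfl
  mul_smul _ _ _ := rfl

/-- `ℓ` is a Lorentzian form: symmetric, of signature `(+,-,…,-)`. Equivalently, there is a vector
`e` with `ℓ(e,e) > 0` such that `ℓ` is negative definite on the `ℓ`-orthogonal complement of `e`. -/
def IsLorentzianForm (ℓ : LinearMap.BilinForm ℝ V) : Prop :=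
  (∀ v w, ℓ v w = ℓ w v) ∧
    ∃ e, 0 < ℓ e e ∧ ∀ v, ℓ e v = 0 → v ≠ 0 → ℓ v v < 0

/-- The closed convex round cone containing `e`, where `ℓ(e,e) > 0`: one of the two cones whose
union is `{v | ℓ(v,v) ≥ 0}`. The other one is `lightCone ℓ (-e)`. -/
def lightCone (ℓ : LinearMap.BilinForm ℝ V) (e : V) : Set V :=
  {v | 0 ≤ ℓ v v ∧ 0 ≤ ℓ e v}

/-- `Γ` is a group of affine transformations of `V` whose linear parts preserve the form `ℓ` and
the cone `C`, and `Γ` (as a discrete group) acts freely and properly on `V`. -/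
structure ActsByLorentzianDeckTransformations (ℓ : LinearMap.BilinForm ℝ V) (C : Set V)
    (Γ : Subgroup (V ≃ᵃ[ℝ] V)) : Prop where
  preserves_form : ∀ γ ∈ Γ, ∀ v w, ℓ (γ.linear v) (γ.linear w) = ℓ v w
  preserves_cone : ∀ γ ∈ Γ, γ.linear '' C = C
  free : ∀ γ ∈ Γ, ∀ v, γ v = v → γ = 1
  proper : ProperlyDiscontinuousSMul Γ V

/-- The quotient space `M = V/Γ`, with the quotient topology. -/
abbrev FlatQuotient (Γ : Subgroup (V ≃ᵃ[ℝ] V)) : Type _ :=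
  MulAction.orbitRel.Quotient Γ V

/-- The quotient mapping `κ : V → V/Γ`. -/
def FlatQuotient.proj (Γ : Subgroup (V ≃ᵃ[ℝ] V)) (v : V) : FlatQuotient Γ :=
  Quotient.mk _ v

/-- The future of `p`: the set `κ(v + C)`, where `κ(v) = p`. -/
def futureSet (C : Set V) (Γ : Subgroup (V ≃ᵃ[ℝ] V)) (p : FlatQuotient Γ) :
    Set (FlatQuotient Γ) :=
  {q | ∃ v, FlatQuotient.proj Γ v = p ∧ ∃ c ∈ C, q = FlatQuotient.proj Γ (v + c)}

/-- The past of `p`: the set `κ(v - C)`, where `κ(v) = p`. -/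
def pastSet (C : Set V) (Γ : Subgroup (V ≃ᵃ[ℝ] V)) (p : FlatQuotient Γ) :
    Set (FlatQuotient Γ) :=
  {q | ∃ v, FlatQuotient.proj Γ v = p ∧ ∃ c ∈ C, q = FlatQuotient.proj Γ (v - c)}

/-- The path `η` in `V/Γ` is smooth and timelike (in the wide sense, including lightlike) on
`[a,b]`: its derivative exists and lies in the cone field `d_vκ(v + C)`. The smooth structure of
`V/Γ` is the one for which `κ` is a local diffeomorphism, so that the smooth paths in `V/Γ` are
those which near each time of `[a,b]` are of the form `κ ∘ c` with `c` a smooth path in `V`; the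
derivative of `η` lies in the cone field if and only if the derivative of `c` lies in `C`. -/
def IsSmoothTimelikeOn (C : Set V) (Γ : Subgroup (V ≃ᵃ[ℝ] V)) (η : ℝ → FlatQuotient Γ)
    (a b : ℝ) : Prop :=
  ∀ t ∈ Icc a b, ∃ c : ℝ → V, ∀ᶠ s in 𝓝[Icc a b] t,
    FlatQuotient.proj Γ (c s) = η s ∧ ContDiffWithinAt ℝ ∞ c (Icc a b) s ∧
      derivWithin c (Icc a b) s ∈ C

/-- The path `η : [0,1] → V/Γ` is piecewise smooth and timelike. -/
def IsPiecewiseSmoothTimelike (C : Set V) (Γ : Subgroup (V ≃ᵃ[ℝ] V)) {p q : FlatQuotient Γ}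
    (η : Path p q) : Prop :=
  ∃ (n : ℕ) (t : ℕ → ℝ), t 0 = 0 ∧ t n = 1 ∧
    ∀ i < n, t i < t (i + 1) ∧ IsSmoothTimelikeOn C Γ η.extend (t i) (t (i + 1))

/-- `V/Γ` is causal: it admits no (nonconstant) closed piecewise smooth timelike path. -/
def IsCausal (C : Set V) (Γ : Subgroup (V ≃ᵃ[ℝ] V)) : Prop :=
  ∀ (p : FlatQuotient Γ) (η : Path p p), IsPiecewiseSmoothTimelike C Γ η → ∀ t, η t = p

/-- `V/Γ` is strictly causal: it is causal, and each point `p` has a neighbourhood `U` such that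
the intersections of `U` with the future and with the past of `p` are closed in `U`. -/
def IsStrictlyCausal (C : Set V) (Γ : Subgroup (V ≃ᵃ[ℝ] V)) : Prop :=
  IsCausal C Γ ∧ ∀ p : FlatQuotient Γ, ∃ U ∈ 𝓝 p,
    IsClosed ((Subtype.val : U → FlatQuotient Γ) ⁻¹' futureSet C Γ p) ∧
    IsClosed ((Subtype.val : U → FlatQuotient Γ) ⁻¹' pastSet C Γ p)

end Lorentz

/-- A group is virtually abelian if it has an abelian subgroup of finite index. -/
def IsVirtuallyAbelian (G : Type*) [Group G] : Prop :=
  ∃ A : Subgroup G, A.FiniteIndex ∧ ∀ a ∈ A, ∀ b ∈ A, a * b = b * a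

/-! If `γ v - v` lay in `C` or `-C`, the segment from `v` to `γ v` would give a closed timelike
path. Causality therefore forces every nontrivial `γ` to displace every point in a spacelike
direction (`IsCausal.form_displacement_neg`). Letting the point go to infinity, every linear part
`λ` satisfies `ℓ(λu,u) ≥ ℓ(u,u)`.

If the linear parts are bounded, a Bieberbach argument applies. Near the identity commutators
contract, so by discreteness iterated commutators die out. Boundedness turns this Engel condition
into commutation of linear parts, and the absence of lightlike translations into commutation in the
group. The elements with linear part near `1` thus generate an abelian subgroup, of finite index by
compactness (`isVirtuallyAbelian_of_commute_near_one`).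

If they are unbounded, a rescaled limit of linear parts has rank one, and the inequality makes its
lightlike image pointwise fixed (`exists_fixed_lightlike_vector`). With `n` spanning that image, the
group acts on `n^⊥/ℝn` by bounded rotations, and boosts conjugate each linear part towards its
rotation (`tendsto_nullBoost_conj`). The Engel condition thus holds for elements with rotation near
`1`, and yields in turn commuting rotations, commuting linear parts and commuting elements. -/

open scoped commutatorElement

/-! ### Elements whose powers all stay near the identity -/

section NormedRing

variable {R : Type*} [NormedRing R] [NormedAlgebra ℝ R]

/-- An element of a real normed algebra whose powers stay within distance `δ < 1` of `1`
is equal to `1`. -/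
theorem eq_one_of_forall_norm_pow_sub_one_le {C : R} {δ : ℝ} (hδ : δ < 1)
    (h : ∀ k : ℕ, ‖C ^ k - 1‖ ≤ δ) : C = 1 := by
  have key : ∀ N : ℕ, (N : ℝ) * ((1 - δ) * ‖C - 1‖) ≤ δ := by
    -- Telescoping the powers: `C - 1` accumulates linearly in `N` unless it vanishes.
    intro N
    have h1 : (N : ℝ) • (C - 1) = (C ^ N - 1) + ∑ k ∈ Finset.range N, (1 - C ^ k) * (C - 1) := by
      rw [← geom_sum_mul, ← Finset.sum_mul, ← add_mul, ← Finset.sum_add_distrib]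
      simp [Nat.cast_smul_eq_nsmul]
    have h2 : ‖(N : ℝ) • (C - 1)‖ ≤ δ + N * (δ * ‖C - 1‖) := by
      rw [h1]
      refine (norm_add_le _ _).trans (add_le_add (h N) ((norm_sum_le _ _).trans ?_))
      refine (Finset.sum_le_card_nsmul _ _ (δ * ‖C - 1‖) fun k _ => ?_).trans (by simp)
      refine (norm_mul_le _ _).trans ?_
      rw [norm_sub_rev]
      exact mul_le_mul_of_nonneg_right (h k) (norm_nonneg _)
    rw [norm_smul, Real.norm_natCast] at h2
    linarith
  by_contra hne
  have hpos : 0 < (1 - δ) * ‖C - 1‖ :=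
    mul_pos (by linarith) (norm_pos_iff.2 (sub_ne_zero.2 hne))
  obtain ⟨N, hN⟩ := exists_nat_gt (δ / ((1 - δ) * ‖C - 1‖))
  rw [div_lt_iff₀ hpos] at hN
  linarith [key N]

end NormedRing

/-! ### Contraction of commutators near the identity -/

section Commutators

variable {G : Type*} [Group G]

/-- The sequence `h, ⁅g, h⁆, ⁅g, ⁅g, h⁆⁆, …` of iterated commutators. -/
def iteratedCommutator (g h : G) : ℕ → G
  | 0 => h
  | k + 1 => ⁅g, iteratedCommutator g h k⁆

theorem iteratedCommutator_succ (g h : G) (k : ℕ) :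
    iteratedCommutator g h (k + 1) = ⁅g, iteratedCommutator g h k⁆ := rfl

theorem commutator_mul_mul (g h : G) : ⁅g, h⁆ * (h * g) = g * h := by
  rw [commutatorElement_def]; group

variable {R : Type*} [NormedRing R] [NormOneClass R] (ρ : G →* R)

theorem norm_map_inv_le_two {g : G} (hg : ‖ρ g - 1‖ ≤ 1 / 2) : ‖ρ g⁻¹‖ ≤ 2 := by
  have h1 : ρ g⁻¹ = 1 - ρ g⁻¹ * (ρ g - 1) := by
    rw [mul_sub, ← map_mul]; simp
  have h2 : ‖ρ g⁻¹‖ ≤ 1 + ‖ρ g⁻¹‖ * (1 / 2) := by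
    calc ‖ρ g⁻¹‖ = ‖1 - ρ g⁻¹ * (ρ g - 1)‖ := by rw [← h1]
      _ ≤ ‖(1 : R)‖ + ‖ρ g⁻¹ * (ρ g - 1)‖ := norm_sub_le _ _
      _ ≤ 1 + ‖ρ g⁻¹‖ * (1 / 2) := by
        rw [norm_one]
        gcongr
        exact (norm_mul_le _ _).trans (by gcongr)
  linarith

/-- With `A = ρ g` and `B = ρ h`, the commutator minus `1` is `((A-1)(B-1) - (B-1)(A-1)) A⁻¹ B⁻¹`,
which is quadratically small; the factor is `2 · 1/16 · 2 · 2 = 1/2`. -/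
theorem norm_map_commutator_sub_one_le {g h : G} (hg : ‖ρ g - 1‖ ≤ 1 / 16)
    (hh : ‖ρ h - 1‖ ≤ 1 / 16) : ‖ρ ⁅g, h⁆ - 1‖ ≤ 1 / 2 * ‖ρ h - 1‖ := by
  have h1 : ρ ⁅g, h⁆ - 1 =
      ((ρ g - 1) * (ρ h - 1) - (ρ h - 1) * (ρ g - 1)) * (ρ g⁻¹ * ρ h⁻¹) := by
    have e1 : (ρ g - 1) * (ρ h - 1) - (ρ h - 1) * (ρ g - 1) = ρ (g * h) - ρ (h * g) := by
      rw [map_mul, map_mul]; noncomm_ring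
    rw [e1, ← map_mul, sub_mul, ← map_mul, ← map_mul, commutatorElement_def]
    congr 1
    · congr 1; group
    · rw [← map_one ρ]; congr 1; group
  have hg2 := norm_map_inv_le_two ρ (hg.trans (by norm_num))
  have hh2 := norm_map_inv_le_two ρ (hh.trans (by norm_num))
  have h3 : ‖(ρ g - 1) * (ρ h - 1) - (ρ h - 1) * (ρ g - 1)‖ ≤ 1 / 8 * ‖ρ h - 1‖ := by
    refine (norm_sub_le _ _).trans ?_
    have a1 := norm_mul_le (ρ g - 1) (ρ h - 1)
    have a2 := norm_mul_le (ρ h - 1) (ρ g - 1)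
    have a3 := mul_le_mul_of_nonneg_right hg (norm_nonneg (ρ h - 1))
    linarith
  have h4 : ‖ρ g⁻¹ * ρ h⁻¹‖ ≤ 4 :=
    (norm_mul_le _ _).trans ((mul_le_mul hg2 hh2 (norm_nonneg _) (by norm_num)).trans (by norm_num))
  rw [h1]
  refine (norm_mul_le _ _).trans ((mul_le_mul h3 h4 (norm_nonneg _) (by positivity)).trans ?_)
  linarith

theorem norm_map_iteratedCommutator_sub_one_le {g h : G} (hg : ‖ρ g - 1‖ ≤ 1 / 16)
    (hh : ‖ρ h - 1‖ ≤ 1 / 16) (k : ℕ) :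
    ‖ρ (iteratedCommutator g h k) - 1‖ ≤ (1 / 2) ^ k * ‖ρ h - 1‖ := by
  induction k with
  | zero => simp [iteratedCommutator]
  | succ k ih =>
    have h1 : ‖ρ (iteratedCommutator g h k) - 1‖ ≤ 1 / 16 := by
      refine ih.trans ((mul_le_of_le_one_left (norm_nonneg _) ?_).trans hh)
      exact pow_le_one₀ (by norm_num) (by norm_num)
    refine (norm_map_commutator_sub_one_le ρ hg h1).trans ?_
    rw [pow_succ]
    linarith

/-- If `ρ` has bounded image and the iterated commutators of `g` with `h` eventually become
trivial, then `ρ g` and `ρ h` commute as soon as they are sufficiently close to `1`. -/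
theorem map_commutator_eq_one_of_iteratedCommutator_eq_one [NormedAlgebra ℝ R] {M : ℝ}
    (hM : 1 ≤ M) (hρ : ∀ g, ‖ρ g‖ ≤ M) {g h : G} (hg : ‖ρ g - 1‖ ≤ 1 / (16 * M ^ 2))
    (hh : ‖ρ h - 1‖ ≤ 1 / (16 * M ^ 2)) {K : ℕ} (hK : iteratedCommutator g h K = 1) :
    ρ ⁅g, h⁆ = 1 := by
  have hM2 : 1 ≤ M ^ 2 := one_le_pow₀ hM
  have hle : 1 / (16 * M ^ 2) ≤ 1 / 16 := by
    apply one_div_le_one_div_of_le <;> linarith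
  -- With `c = ⁅g, b⁆` and `ρ g` commuting with `ρ c`, conjugating `b` by `g ^ j` gives `ρ c ^ j * ρ
  -- b`. Conjugation by bounded elements expands distances to `1` by at most `M ^ 2`, so all powers
  -- of `ρ c` stay near `1`.
  have step : ∀ k, ρ (iteratedCommutator g h (k + 2)) = 1 →
      ρ (iteratedCommutator g h (k + 1)) = 1 := by
    intro k hk
    set b := iteratedCommutator g h k with hb
    set c := iteratedCommutator g h (k + 1) with hc
    have hcb : c * b = g * b * g⁻¹ := by
      rw [hc, iteratedCommutator_succ, ← hb, commutatorElement_def]; group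
    have hcomm : ρ g * ρ c = ρ c * ρ g := by
      rw [iteratedCommutator_succ, ← hc] at hk
      rw [← map_mul, ← map_mul, ← commutator_mul_mul, map_mul, hk, one_mul]
    have hpow : ∀ j : ℕ, ρ (g ^ j * b * (g ^ j)⁻¹) = ρ c ^ j * ρ b := by
      intro j
      induction j with
      | zero => simp
      | succ j ih =>
        have : g ^ (j + 1) * b * (g ^ (j + 1))⁻¹ = g * (g ^ j * b * (g ^ j)⁻¹) * g⁻¹ := by
          rw [pow_succ']; group
        rw [this, map_mul, map_mul, ih, ← mul_assoc, ((show Commute (ρ g) (ρ c) from hcomm).pow_right j).eq,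
          mul_assoc, mul_assoc, ← mul_assoc (ρ g), ← map_mul, ← map_mul, ← hcb, map_mul,
          ← mul_assoc, ← pow_succ]
    have hb1 : ‖ρ b - 1‖ ≤ 1 / (16 * M ^ 2) := by
      refine (norm_map_iteratedCommutator_sub_one_le ρ (hg.trans hle) (hh.trans hle) k).trans ?_
      refine (mul_le_of_le_one_left (norm_nonneg _) ?_).trans hh
      exact pow_le_one₀ (by norm_num) (by norm_num)
    have hb2 := norm_map_inv_le_two ρ (hb1.trans (hle.trans (by norm_num)))
    refine eq_one_of_forall_norm_pow_sub_one_le (δ := 1 / 2) (by norm_num) fun j => ?_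
    have e1 : ρ c ^ j - 1 = ((ρ (g ^ j) * (ρ b - 1) * ρ (g ^ j)⁻¹) - (ρ b - 1)) * ρ b⁻¹ := by
      have : ρ (g ^ j) * (ρ b - 1) * ρ (g ^ j)⁻¹ = ρ c ^ j * ρ b - 1 := by
        rw [← hpow, mul_sub, sub_mul, map_mul, map_mul, mul_one, ← map_mul _ (g ^ j) (g ^ j)⁻¹]
        simp
      rw [this, sub_sub_sub_cancel_right, sub_mul, mul_assoc, ← map_mul]
      simp
    have e2 : ‖ρ (g ^ j) * (ρ b - 1) * ρ (g ^ j)⁻¹‖ ≤ 1 / 16 := by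
      calc _ ≤ ‖ρ (g ^ j)‖ * ‖ρ b - 1‖ * ‖ρ (g ^ j)⁻¹‖ := norm_mul₃_le
        _ ≤ M * (1 / (16 * M ^ 2)) * M := by
          gcongr
          · exact hρ _
          · exact hρ _
        _ = 1 / 16 := by field_simp
    rw [e1]
    refine (norm_mul_le _ _).trans ?_
    have e3 := (norm_sub_le (ρ (g ^ j) * (ρ b - 1) * ρ (g ^ j)⁻¹) (ρ b - 1))
    have e4 := mul_le_mul (e3.trans (add_le_add e2 (hb1.trans hle))) hb2 (norm_nonneg _)
      (by norm_num)
    linarith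
  -- The shift by one makes the descent end at `⁅g, h⁆`, not at `h`.
  have hK1 : ρ (iteratedCommutator g h (K + 1)) = 1 := by
    rw [iteratedCommutator_succ, hK]; simp
  clear hK
  induction K with
  | zero => exact hK1
  | succ K ih => exact ih (step K hK1)

end Commutators

/-! ### Translation cocycles and the Engel condition -/

section Cocycle

variable {G : Type*} [Group G] {E : Type*} [NormedAddCommGroup E] [NormedSpace ℝ E]
  {ρ : G →* (E →L[ℝ] E)} {v : G → E}

theorem cocycle_one (hv : ∀ g h, v (g * h) = v g + ρ g (v h)) : v 1 = 0 := by
  simpa using hv 1 1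

/-- Obtained by evaluating the cocycle on both sides of `⁅g, h⁆ * (h * g) = g * h`. -/
theorem cocycle_commutator (hv : ∀ g h, v (g * h) = v g + ρ g (v h)) (g h : G) :
    v ⁅g, h⁆ = (ρ g - ρ ⁅g, h⁆) (v h) + (1 - ρ ⁅g, h⁆ * ρ h) (v g) := by
  have h1 := hv ⁅g, h⁆ (h * g)
  rw [commutator_mul_mul, hv g h, hv h g] at h1
  have h2 : (ρ ⁅g, h⁆ * ρ h) (v g) = ρ ⁅g, h⁆ (ρ h (v g)) := rfl
  rw [map_add] at h1
  rw [sub_apply, sub_apply, one_apply_eq_self, h2, eq_sub_of_add_eq h1.symm]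
  abel

theorem map_inv_eq_one_of_map_eq_one (ρ : G →* (E →L[ℝ] E)) {u : G} (hu : ρ u = 1) :
    ρ u⁻¹ = 1 := by
  have h1 := map_mul ρ u u⁻¹
  rw [mul_inv_cancel, map_one, hu, one_mul] at h1
  exact h1.symm

theorem cocycle_inv_of_map_eq_one (hv : ∀ g h, v (g * h) = v g + ρ g (v h)) {u : G}
    (hu : ρ u = 1) : v u⁻¹ = -v u := by
  have h1 := hv u u⁻¹
  rw [mul_inv_cancel, cocycle_one hv, hu] at h1
  exact (neg_eq_of_add_eq_zero_right h1.symm).symm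

theorem cocycle_commutator_of_map_eq_one (hv : ∀ g h, v (g * h) = v g + ρ g (v h)) (g : G) {u : G}
    (hu : ρ u = 1) : v ⁅g, u⁆ = ρ g (v u) - v u := by
  have h1 : ρ ⁅g, u⁆ = 1 := by
    rw [commutatorElement_def, map_mul, map_mul, map_mul, hu, mul_one, ← map_mul, mul_inv_cancel,
      map_one, one_mul, map_inv_eq_one_of_map_eq_one ρ hu]
  rw [cocycle_commutator hv, h1, hu]
  simp

theorem map_iteratedCommutator_eq_one (ρ : G →* (E →L[ℝ] E)) {g h : G} (hgh : ρ ⁅g, h⁆ = 1)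
    (k : ℕ) : ρ (iteratedCommutator g h (k + 1)) = 1 := by
  induction k with
  | zero => exact hgh
  | succ k ih =>
    rw [iteratedCommutator_succ, commutatorElement_def, map_mul, map_mul, map_mul, ih,
      map_inv_eq_one_of_map_eq_one ρ ih,
      mul_one, mul_one, ← map_mul, mul_inv_cancel, map_one]

/-- An Engel condition forces the cocycle of the commutator to be fixed by `g`, if there are no
nonzero isotropic translations. -/
theorem map_cocycle_commutator_eq_self (q : LinearMap.BilinForm ℝ E)
    (hq : ∀ g x y, q (ρ g x) (ρ g y) = q x y)
    (hv : ∀ g h, v (g * h) = v g + ρ g (v h))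
    (hiso : ∀ u, ρ u = 1 → q (v u) (v u) = 0 → v u = 0)
    {g h : G} (hgh : ρ ⁅g, h⁆ = 1) {K : ℕ} (hK : iteratedCommutator g h K = 1) :
    ρ g (v ⁅g, h⁆) = v ⁅g, h⁆ := by
  have hinv : ∀ x, ρ g x = x → ∀ y, q x (ρ g y - y) = 0 := by
    intro x hx y
    have := hq g x y
    rw [hx] at this
    rw [map_sub, this, sub_self]
  have hnext : ∀ k, v (iteratedCommutator g h (k + 2)) =
      ρ g (v (iteratedCommutator g h (k + 1))) - v (iteratedCommutator g h (k + 1)) := fun k =>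
    cocycle_commutator_of_map_eq_one hv g (map_iteratedCommutator_eq_one ρ hgh k)
  -- The vector at `k + 2` is in the image of `ρ g - 1` and, by hypothesis, in its kernel. These are
  -- `q`-orthogonal for an isometry, so the vector is isotropic.
  have step : ∀ k, v (iteratedCommutator g h (k + 3)) = 0 →
      v (iteratedCommutator g h (k + 2)) = 0 := by
    intro k hk
    refine hiso _ (map_iteratedCommutator_eq_one ρ hgh (k + 1)) ?_
    rw [hnext (k + 1), sub_eq_zero] at hk
    conv_lhs => rw [hnext k]
    have := hinv _ hk (v (iteratedCommutator g h (k + 1)))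
    rwa [hnext k] at this
  have hK2 : v (iteratedCommutator g h (K + 2)) = 0 := by
    rw [iteratedCommutator_succ, iteratedCommutator_succ, hK]
    simp [cocycle_one hv]
  have h2 : v (iteratedCommutator g h 2) = 0 := by
    clear hK
    induction K with
    | zero => exact hK2
    | succ K ih => exact ih (step K hK2)
  rw [hnext 0, sub_eq_zero] at h2
  exact h2

/-- Two elements with commuting linear parts which satisfy an Engel condition in both orders have
trivial commutator cocycle, if there are no nonzero isotropic translations. -/
theorem cocycle_commutator_eq_zero (q : LinearMap.BilinForm ℝ E)
    (hq : ∀ g x y, q (ρ g x) (ρ g y) = q x y)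
    (hv : ∀ g h, v (g * h) = v g + ρ g (v h))
    (hiso : ∀ u, ρ u = 1 → q (v u) (v u) = 0 → v u = 0)
    {g h : G} (hgh : ρ ⁅g, h⁆ = 1) {K K' : ℕ} (hK : iteratedCommutator g h K = 1)
    (hK' : iteratedCommutator h g K' = 1) : v ⁅g, h⁆ = 0 := by
  have hhg : ρ ⁅h, g⁆ = 1 := by
    rw [← commutatorElement_inv]
    exact map_inv_eq_one_of_map_eq_one ρ hgh
  have h1 := map_cocycle_commutator_eq_self q hq hv hiso hgh hK
  have h2 := map_cocycle_commutator_eq_self q hq hv hiso hhg hK'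
  rw [← commutatorElement_inv, cocycle_inv_of_map_eq_one hv hgh, map_neg, neg_inj] at h2
  refine hiso _ hgh ?_
  -- Being fixed by both `ρ g` and `ρ h`, the vector is orthogonal to both summands, hence to
  -- itself.
  have h3 : v ⁅g, h⁆ = (ρ g (v h) - v h) - (ρ h (v g) - v g) := by
    have := cocycle_commutator hv g h
    rw [hgh] at this
    simp only [sub_apply, one_apply_eq_self, one_mul] at this
    rw [this]; abel
  have hinv : ∀ a x, ρ a x = x → ∀ y, q x (ρ a y - y) = 0 := by
    intro a x hx y
    have := hq a x y
    rw [hx] at this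
    rw [map_sub, this, sub_self]
  conv_lhs => rw [h3]
  rw [← h3, h3, map_sub, ← h3, hinv g _ h1, hinv h _ h2, sub_zero]

/-- In a discrete group of affine transformations, iterated commutators of elements whose linear
parts are close to `1` eventually become trivial. -/
theorem exists_iteratedCommutator_eq_one [Nontrivial E]
    (hv : ∀ g h, v (g * h) = v g + ρ g (v h))
    {r : ℝ} (hr : 0 < r) (hdisc : ∀ g, ‖v g‖ < r → g = 1) {g h : G}
    (hg : ‖ρ g - 1‖ ≤ 1 / 16) (hh : ‖ρ h - 1‖ ≤ 1 / 16) :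
    ∃ K, iteratedCommutator g h K = 1 := by
  set B := max ‖v h‖ (‖v g‖) with hB
  have hB0 : 0 ≤ B := le_max_of_le_left (norm_nonneg _)
  -- The term carrying the fixed vector `v g` also decays, because its coefficient is controlled by
  -- `ρ b - 1`. The recursion gives `1/8 + 1/4 ≤ 1/2`.
  have hbound : ∀ k, ‖v (iteratedCommutator g h k)‖ ≤ (1 / 2) ^ k * B := by
    intro k
    induction k with
    | zero => simp [iteratedCommutator, hB]
    | succ k ih =>
      set b := iteratedCommutator g h k with hb
      have hp : (0 : ℝ) ≤ (1 / 2) ^ k := by positivity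
      have hp1 : ((1 : ℝ) / 2) ^ k ≤ 1 := pow_le_one₀ (by norm_num) (by norm_num)
      have b1 : ‖ρ b - 1‖ ≤ (1 / 2) ^ k * (1 / 16) :=
        (norm_map_iteratedCommutator_sub_one_le ρ hg hh k).trans
          (mul_le_mul_of_nonneg_left hh hp)
      have b1' : ‖ρ b - 1‖ ≤ 1 / 16 := b1.trans (by linarith)
      have b2 := norm_map_commutator_sub_one_le ρ hg b1'
      have b3 : ‖ρ g - ρ ⁅g, b⁆‖ ≤ 1 / 8 := by
        have : ρ g - ρ ⁅g, b⁆ = (ρ g - 1) - (ρ ⁅g, b⁆ - 1) := by abel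
        rw [this]
        refine (norm_sub_le _ _).trans ?_
        linarith
      have b4 : ‖1 - ρ ⁅g, b⁆ * ρ b‖ ≤ (1 / 2) ^ k * (1 / 4) := by
        have : 1 - ρ ⁅g, b⁆ * ρ b =
            -((ρ ⁅g, b⁆ - 1) * (ρ b - 1) + (ρ ⁅g, b⁆ - 1) + (ρ b - 1)) := by noncomm_ring
        rw [this, norm_neg]
        refine (norm_add₃_le).trans ?_
        have c1 := norm_mul_le (ρ ⁅g, b⁆ - 1) (ρ b - 1)
        have c2 := mul_le_mul_of_nonneg_left b1' (norm_nonneg (ρ ⁅g, b⁆ - 1))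
        linarith
      rw [iteratedCommutator_succ, ← hb, cocycle_commutator hv]
      refine (norm_add_le _ _).trans ?_
      have d1 := (ρ g - ρ ⁅g, b⁆).le_opNorm (v b)
      have d2 := (1 - ρ ⁅g, b⁆ * ρ b).le_opNorm (v g)
      have d3 := mul_le_mul b3 ih (norm_nonneg _) (by norm_num)
      have d4 := mul_le_mul b4 (le_max_right ‖v h‖ ‖v g‖) (norm_nonneg _) (by positivity)
      rw [← hB] at d4
      have : (0 : ℝ) ≤ (1 / 2) ^ k * B := by positivity
      rw [pow_succ]
      linarith
  have hlim : Tendsto (fun k : ℕ => ((1 : ℝ) / 2) ^ k * B) atTop (𝓝 0) := by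
    simpa using (tendsto_pow_atTop_nhds_zero_of_lt_one (r := (1 : ℝ) / 2) (by norm_num)
      (by norm_num)).mul_const B
  obtain ⟨K, hK⟩ := (hlim.eventually (gt_mem_nhds hr)).exists
  exact ⟨K, hdisc _ ((hbound K).trans_lt hK)⟩

/-- A version of `exists_iteratedCommutator_eq_one` where closeness to `1` is measured after
conjugation by an invertible linear map `D`. -/
theorem exists_iteratedCommutator_eq_one_of_conj [Nontrivial E]
    (hv : ∀ g h, v (g * h) = v g + ρ g (v h))
    {r : ℝ} (hr : 0 < r) (hdisc : ∀ g, ‖v g‖ < r → g = 1) {D D' : E →L[ℝ] E}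
    (hD : D' * D = 1) (hD' : D * D' = 1) {g h : G}
    (hg : ‖D * ρ g * D' - 1‖ ≤ 1 / 16) (hh : ‖D * ρ h * D' - 1‖ ≤ 1 / 16) :
    ∃ K, iteratedCommutator g h K = 1 := by
  let ρ' : G →* (E →L[ℝ] E) :=
    { toFun := fun g => D * ρ g * D'
      map_one' := by simp [hD']
      map_mul' := fun a b => by
        rw [map_mul]
        calc D * (ρ a * ρ b) * D' = D * ρ a * 1 * ρ b * D' := by noncomm_ring
          _ = _ := by rw [← hD]; noncomm_ring }
  have happ : ∀ x, D' (D x) = x := fun x => congrArg (fun T : E →L[ℝ] E => T x) hD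
  refine exists_iteratedCommutator_eq_one (ρ := ρ') (v := fun g => D (v g)) (r := r / (‖D'‖ + 1))
    (fun a b => ?_) (by positivity) (fun a ha => hdisc a ?_) hg hh
  · simp only [hv, map_add]
    change _ = _ + (D * ρ a * D') (D (v b))
    simp [happ]
  · rw [lt_div_iff₀ (by positivity)] at ha
    calc ‖v a‖ = ‖D' (D (v a))‖ := by rw [happ]
      _ ≤ ‖D'‖ * ‖D (v a)‖ := D'.le_opNorm _
      _ ≤ ‖D (v a)‖ * (‖D'‖ + 1) := by nlinarith [norm_nonneg (D (v a))]
      _ < r := ha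

end Cocycle

/-! ### Finite index from total boundedness -/

section VirtuallyAbelian

/-- A group with a bounded finite-dimensional representation, in which elements represented near
the identity commute with each other, is virtually abelian. -/
theorem isVirtuallyAbelian_of_commute_near_one {G : Type*} [Group G] {E : Type*}
    [NormedAddCommGroup E] [NormedSpace ℝ E] [FiniteDimensional ℝ E]
    (ρ : G →* (E →L[ℝ] E)) {M : ℝ} (hρ : ∀ g, ‖ρ g‖ ≤ M) {ε : ℝ} (hε : 0 < ε)
    (hcomm : ∀ g h, ‖ρ g - 1‖ < ε → ‖ρ h - 1‖ < ε → g * h = h * g) :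
    IsVirtuallyAbelian G := by
  have hM : 0 ≤ M := (norm_nonneg _).trans (hρ 1)
  set S : Set G := {g | ‖ρ g - 1‖ < ε} with hS
  refine ⟨Subgroup.closure S, ?_, ?_⟩
  · have htb : TotallyBounded (range ρ) :=
      (ProperSpace.isCompact_closedBall (0 : E →L[ℝ] E) M).totallyBounded.subset (by
        rintro _ ⟨g, rfl⟩; simpa using hρ g)
    -- Two elements sharing a net centre differ by less than `2 * δ`, so `g⁻¹ * h` is within `M * (2
    -- * δ) < ε` of `1`; the `+ 1` gives strictness and covers `M = 0`.
    set δ := ε / (2 * (M + 1)) with hδ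
    have hδ0 : 0 < δ := by positivity
    obtain ⟨t, ht, hcov⟩ := Metric.totallyBounded_iff.1 htb δ hδ0
    have hex : ∀ g, ∃ y ∈ t, dist (ρ g) y < δ := fun g => by
      simpa using hcov (mem_range_self g)
    choose f hft hf using hex
    have hmem : ∀ g h, f g = f h → g⁻¹ * h ∈ Subgroup.closure S := by
      intro g h hfg
      refine Subgroup.subset_closure ?_
      have h1 : ρ (g⁻¹ * h) - 1 = ρ g⁻¹ * (ρ h - ρ g) := by
        rw [mul_sub, ← map_mul, ← map_mul]; simp
      have h2 : ‖ρ h - ρ g‖ < 2 * δ := by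
        rw [← dist_eq_norm]
        have := dist_triangle_right (ρ h) (ρ g) (f g)
        have a1 := hf g
        have a2 := hf h
        rw [← hfg] at a2
        linarith
      change ‖ρ (g⁻¹ * h) - 1‖ < ε
      rw [h1]
      have e1 : (M + 1) * (2 * δ) = ε := by rw [hδ]; field_simp
      calc ‖ρ g⁻¹ * (ρ h - ρ g)‖ ≤ ‖ρ g⁻¹‖ * ‖ρ h - ρ g‖ := norm_mul_le _ _
        _ ≤ M * ‖ρ h - ρ g‖ := mul_le_mul_of_nonneg_right (hρ _) (norm_nonneg _)
        _ ≤ M * (2 * δ) := mul_le_mul_of_nonneg_left h2.le hM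
        _ < (M + 1) * (2 * δ) := by nlinarith
        _ = ε := e1
    have : Finite t := ht
    have hfin : Finite (G ⧸ Subgroup.closure S) := by
      refine Finite.of_injective (β := t) (fun x => ⟨f x.out, hft _⟩) fun x y hxy => ?_
      have := hmem _ _ (Subtype.ext_iff.1 hxy)
      rw [← QuotientGroup.eq, QuotientGroup.out_eq', QuotientGroup.out_eq'] at this
      exact this
    exact Subgroup.finiteIndex_of_finite_quotient
  · intro a ha b hb
    induction ha, hb using Subgroup.closure_induction₂ with
    | mem x y hx hy => exact hcomm x y hx hy
    | one_left x _ => simp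
    | one_right x _ => simp
    | mul_left x y z _ _ _ h1 h2 => exact (Commute.mul_left h1 h2).eq
    | mul_right x y z _ _ _ h1 h2 => exact (Commute.mul_right h1 h2).eq
    | inv_left x y _ _ h1 => exact (Commute.inv_left (show Commute x y from h1)).eq
    | inv_right x y _ _ h1 => exact (Commute.inv_right (show Commute x y from h1)).eq

theorem IsVirtuallyAbelian.of_mulEquiv {G H : Type*} [Group G] [Group H]
    (φ : G ≃* H) (hH : IsVirtuallyAbelian H) : IsVirtuallyAbelian G := by
  obtain ⟨A, hA, hcomm⟩ := hH
  refine ⟨A.comap φ.toMonoidHom, ⟨?_⟩, fun a ha b hb => φ.injective ?_⟩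
  · rw [Subgroup.index_comap_of_surjective _ φ.surjective]
    exact hA.index_ne_zero
  · rw [map_mul, map_mul]
    exact hcomm _ ha _ hb

end VirtuallyAbelian

/-! ### Lorentzian geometry and the fixed lightlike vector -/

section LorentzianForm

variable {V : Type*} [NormedAddCommGroup V] [NormedSpace ℝ V] {ℓ : LinearMap.BilinForm ℝ V}

/-- For a Lorentzian form, a vector orthogonal to a nonzero non-spacelike vector `u` is either
spacelike or proportional to `u`. -/
theorem IsLorentzianForm.exists_eq_smul (hℓ : IsLorentzianForm ℓ) {u w : V} (hu0 : u ≠ 0)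
    (hu : 0 ≤ ℓ u u) (hw : 0 ≤ ℓ w w) (huw : ℓ u w = 0) : ∃ s : ℝ, w = s • u := by
  obtain ⟨hsymm, e, -, hneg⟩ := hℓ
  have heu : ℓ e u ≠ 0 := fun h => (hneg u h hu0).not_ge hu
  -- This combination is orthogonal to `e`, yet its square is a nonnegative combination of `ℓ u u`
  -- and `ℓ w w`.
  have hz : ℓ e u • w - ℓ e w • u = 0 := by
    by_contra hne
    refine (hneg _ ?_ hne).not_ge ?_
    · simp only [map_sub, map_smul, smul_eq_mul]; ring
    · have hwu : ℓ w u = 0 := by rw [hsymm, huw]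
      simp only [map_sub, map_smul, smul_eq_mul, LinearMap.sub_apply, LinearMap.smul_apply, huw,
        hwu]
      nlinarith [mul_nonneg (sq_nonneg (ℓ e u)) hw, mul_nonneg (sq_nonneg (ℓ e w)) hu]
  refine ⟨(ℓ e u)⁻¹ * ℓ e w, ?_⟩
  rw [mul_smul, ← sub_eq_zero.1 hz, smul_smul, inv_mul_cancel₀ heu, one_smul]

theorem IsLorentzianForm.eq_zero_of_forall (hℓ : IsLorentzianForm ℓ) {u : V}
    (hu : ∀ w, ℓ u w = 0) : u = 0 := by
  obtain ⟨hsymm, e, -, hneg⟩ := hℓ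
  by_contra hne
  exact (hneg u (by rw [hsymm, hu]) hne).ne (hu u)

/-- If the product of two linear functionals is everywhere nonnegative, then they are
proportional. -/
theorem eq_mul_of_forall_mul_nonneg {f g : V →ₗ[ℝ] ℝ} (hfg : ∀ u, 0 ≤ f u * g u) {v : V}
    (hv : f v = 1) (u : V) : g u = f u * g v := by
  have hker : ∀ w, f w = 0 → g w = 0 := by
    intro w hw
    by_contra hne
    -- On this vector `f` is `1` and `g` is `-1`.
    have := hfg (v - ((g v + 1) / g w) • w)
    simp only [map_sub, map_smul, smul_eq_mul, hv, hw] at this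
    rw [div_mul_cancel₀ _ hne] at this
    linarith
  have := hker (u - f u • v) (by simp [hv])
  simpa [sub_eq_zero] using this

theorem map_apply_inv_apply {G : Type*} [Group G] (ρ : G →* (V →L[ℝ] V)) (g : G) (x : V) : ρ g (ρ g⁻¹ x) = x := by
  have h := map_mul ρ g g⁻¹
  rw [mul_inv_cancel, map_one] at h
  exact (congrArg (fun T : V →L[ℝ] V => T x) h).symm

variable [FiniteDimensional ℝ V]

theorem continuous_bilinForm (ℓ : LinearMap.BilinForm ℝ V) :
    Continuous fun x : V × V => ℓ x.1 x.2 := by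
  have h : Continuous fun x : V × V => LinearMap.toContinuousLinearMap (ℓ x.1) x.2 := by
    have h1 : Continuous fun x : V => LinearMap.toContinuousLinearMap (ℓ x) :=
      LinearMap.continuous_of_finiteDimensional
        ((LinearMap.toContinuousLinearMap (𝕜 := ℝ) (E := V) (F' := ℝ)).toLinearMap ∘ₗ ℓ)
    exact (h1.comp continuous_fst).clm_apply continuous_snd
  exact h

variable {G : Type*} [Group G] {ρ : G →* (V →L[ℝ] V)}

/-- An unbounded group of Lorentz transformations `λ` satisfying `ℓ(λu,u) ≥ ℓ(u,u)` for all `u`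
fixes a nonzero lightlike vector. -/
theorem exists_fixed_lightlike_vector (hℓ : IsLorentzianForm ℓ)
    (hpres : ∀ g x y, ℓ (ρ g x) (ρ g y) = ℓ x y) (hpos : ∀ g u, ℓ u u ≤ ℓ (ρ g u) u)
    (hunb : ∀ M : ℝ, ∃ g, M < ‖ρ g‖) : ∃ n, n ≠ 0 ∧ ℓ n n = 0 ∧ ∀ g, ρ g n = n := by
  have hsymm := hℓ.1
  choose s hs using fun k : ℕ => hunb (k + 1)
  have hs0 : ∀ k, 0 < ‖ρ (s k)‖ := fun k => lt_trans (by positivity) (hs k)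
  have hmem : ∀ k, ‖ρ (s k)‖⁻¹ • ρ (s k) ∈ Metric.sphere (0 : V →L[ℝ] V) 1 := fun k => by
    simp [norm_smul, (hs0 k).ne']
  obtain ⟨X, hX1, φ, hφ, hX⟩ := (isCompact_sphere (0 : V →L[ℝ] V) 1).tendsto_subseq hmem
  have hX1 : ‖X‖ = 1 := by simpa using hX1
  have hinv : Tendsto (fun k => ‖ρ (s (φ k))‖⁻¹) atTop (𝓝 0) := by
    refine tendsto_inv_atTop_zero.comp (tendsto_atTop_mono (fun k => ?_)
      (tendsto_natCast_atTop_atTop (R := ℝ)))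
    have h1 : (k : ℝ) ≤ φ k := by exact_mod_cast hφ.id_le k
    linarith [hs (φ k)]
  have hXapp : ∀ v, Tendsto (fun k => ‖ρ (s (φ k))‖⁻¹ • ρ (s (φ k)) v) atTop (𝓝 (X v)) :=
    fun v => ((ContinuousLinearMap.apply ℝ V v).continuous.tendsto X).comp hX
  -- Rescaling kills the preserved form in the limit, so `X` has totally isotropic image, which is a
  -- line in Lorentzian signature.
  have hXX : ∀ v w, ℓ (X v) (X w) = 0 := by
    intro v w
    have h1 := ((continuous_bilinForm ℓ).tendsto (X v, X w)).comp
      ((hXapp v).prodMk_nhds (hXapp w))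
    refine tendsto_nhds_unique h1 ?_
    have h2 := (hinv.mul hinv).mul_const (ℓ v w)
    simp only [mul_zero, zero_mul] at h2
    refine h2.congr fun k => ?_
    simp [hpres, mul_assoc]
  -- The positivity is applied to `g * s (φ k)`, so that the limit carries information on every `g`.
  have hXpos : ∀ g u, 0 ≤ ℓ (ρ g (X u)) u := by
    intro g u
    have h1 := ((continuous_bilinForm ℓ).tendsto (ρ g (X u), u)).comp
      ((((ρ g).continuous.tendsto _).comp (hXapp u)).prodMk_nhds
        (tendsto_const_nhds (x := u)))
    refine le_of_tendsto_of_tendsto (by simpa using hinv.mul_const (ℓ u u)) h1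
      (Eventually.of_forall fun k => ?_)
    have h2 := hpos (g * s (φ k)) u
    rw [map_mul] at h2
    have h3 := mul_le_mul_of_nonneg_left h2 (inv_nonneg.2 (hs0 (φ k)).le)
    simpa using h3
  obtain ⟨v, hv⟩ : ∃ v, X v ≠ 0 := by
    by_contra! h
    have : X = 0 := ContinuousLinearMap.ext h
    simp [this] at hX1
  set n := X v with hn
  have hnn : ℓ n n = 0 := hXX v v
  have hpar : ∀ u, ∃ c : ℝ, X u = c • n := fun u =>
    hℓ.exists_eq_smul hv hnn.ge (hXX u u).ge (hXX v u)
  obtain ⟨f, hf⟩ : ∃ f : V →ₗ[ℝ] ℝ, ∀ u, X u = f u • n := by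
    obtain ⟨e, -, hneg⟩ := hℓ.2
    have hen : ℓ e n ≠ 0 := fun h => (hneg n h hv).ne hnn
    refine ⟨(ℓ e n)⁻¹ • (ℓ e ∘ₗ (X : V →ₗ[ℝ] V)), fun u => ?_⟩
    obtain ⟨c, hc⟩ := hpar u
    simp only [LinearMap.smul_apply, LinearMap.comp_apply, ContinuousLinearMap.coe_coe, hc, map_smul,
      smul_eq_mul]
    rw [mul_comm c, inv_mul_cancel_left₀ hen]
  have hfv : f v = 1 := by
    have h1 : (f v - 1) • n = 0 := by rw [sub_smul, ← hf, one_smul, sub_self]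
    rcases smul_eq_zero.1 h1 with h | h
    · linarith
    · exact absurd h hv
  -- All the functionals `ℓ (ρ g n)` are proportional to `f`; by nondegeneracy `n` is a common
  -- eigenvector.
  have hprop : ∀ g u, ℓ (ρ g n) u = f u * ℓ (ρ g n) v := fun g =>
    eq_mul_of_forall_mul_nonneg (f := f) (g := ℓ (ρ g n)) (fun u => by
      have := hXpos g u
      rwa [hf, map_smul, map_smul, LinearMap.smul_apply, smul_eq_mul] at this) hfv
  have hprop1 : ∀ u, ℓ n u = f u * ℓ n v := by simpa using hprop 1
  have hnv : ℓ n v ≠ 0 := fun h => hv (hℓ.eq_zero_of_forall fun w => by rw [hprop1, h, mul_zero])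
  have heig : ∀ g, ρ g n = (ℓ (ρ g n) v / ℓ n v) • n := fun g => by
    refine sub_eq_zero.1 (hℓ.eq_zero_of_forall fun w => ?_)
    rw [map_sub, map_smul, LinearMap.sub_apply, LinearMap.smul_apply, hprop g w, hprop1 w,
      smul_eq_mul]
    field_simp
    ring
  refine ⟨n, hv, hnn, fun g => ?_⟩
  set χ := ℓ (ρ g n) v / ℓ n v with hχ
  have hg : ρ g n = χ • n := heig g
  set χ' := ℓ (ρ g⁻¹ n) v / ℓ n v with hχ'
  have hg' : ρ g⁻¹ n = χ' • n := heig g⁻¹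
  have hmul : χ * χ' = 1 := by
    have h1 := map_apply_inv_apply ρ g n
    rw [hg', map_smul, hg, smul_smul] at h1
    have h2 : (χ' * χ - 1) • n = 0 := by rw [sub_smul, h1, one_smul, sub_self]
    rcases smul_eq_zero.1 h2 with h | h
    · linarith
    · exact absurd h hv
  have hwn : ℓ (ρ g v) n = χ' * ℓ n v := by
    have h1 := hpres g v (ρ g⁻¹ n)
    rw [map_apply_inv_apply, hg', map_smul, smul_eq_mul, hsymm v n] at h1
    exact h1
  -- first-order variation of `ℓ(λu,u) ≥ ℓ(u,u)` at `u = n`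
  have hquad : ∀ t : ℝ, 0 ≤ t * ((χ + χ' - 2) * ℓ n v) + t ^ 2 * (ℓ (ρ g v) v - ℓ v v) := by
    intro t
    have h1 := hpos g (n + t • v)
    simp only [map_add, map_smul, LinearMap.add_apply, LinearMap.smul_apply, smul_eq_mul, hg, hnn,
      hwn, hsymm v n] at h1
    linarith
  have hlin : (χ + χ' - 2) * ℓ n v = 0 := by
    set a := (χ + χ' - 2) * ℓ n v
    set b := ℓ (ρ g v) v - ℓ v v
    by_contra hne
    -- A small step against the sign of `a` makes the linear term beat the quadratic one.
    have h1 := hquad (-a / (|b| + 1))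
    have hb : 0 < |b| + 1 := by positivity
    have h2 : -a / (|b| + 1) * a + (-a / (|b| + 1)) ^ 2 * b =
        a ^ 2 * (b - (|b| + 1)) / (|b| + 1) ^ 2 := by field_simp; ring
    rw [h2] at h1
    have h3 : a ^ 2 * (b - (|b| + 1)) < 0 :=
      mul_neg_of_pos_of_neg (by positivity) (by linarith [le_abs_self b])
    exact (div_neg_of_neg_of_pos h3 (by positivity)).not_ge h1
  have hsum : χ + χ' - 2 = 0 := (mul_eq_zero.1 hlin).resolve_right hnv
  -- From `χ * χ' = 1` and `χ + χ' = 2`.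
  have hχ1 : χ = 1 := by
    have : (χ - 1) ^ 2 = 0 := by
      have : χ' = 2 - χ := by linarith
      rw [this] at hmul
      linarith
    linarith [pow_eq_zero_iff (two_ne_zero) |>.1 this]
  rw [hg, hχ1, one_smul]

/-- Compactness of the unit sphere makes `Q` comparable to the squared norm; the square root of the
ratio of its extreme values there is the bound. -/
theorem exists_norm_le_of_preserves_posDef (Q : LinearMap.BilinForm ℝ V)
    (hQ : ∀ x, x ≠ 0 → 0 < Q x x) (hpres : ∀ g x, Q (ρ g x) (ρ g x) = Q x x) :
    ∃ M : ℝ, ∀ g, ‖ρ g‖ ≤ M := by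
  rcases subsingleton_or_nontrivial V with hV | hV
  · exact ⟨0, fun g => (ContinuousLinearMap.opNorm_le_bound _ le_rfl fun x => by
      simp [Subsingleton.elim x 0])⟩
  have hcont : Continuous fun x : V => Q x x :=
    (continuous_bilinForm Q).comp (continuous_id.prodMk continuous_id)
  have hcomp := isCompact_sphere (0 : V) 1
  have hne : (Metric.sphere (0 : V) 1).Nonempty := NormedSpace.sphere_nonempty.2 zero_le_one
  obtain ⟨a, ha, hmin⟩ := hcomp.exists_isMinOn hne hcont.continuousOn
  obtain ⟨b, hb, hmax⟩ := hcomp.exists_isMaxOn hne hcont.continuousOn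
  have ha0 : 0 < Q a a := hQ a (by rintro rfl; simp at ha)
  have hscale : ∀ x : V, x ≠ 0 → ‖x‖⁻¹ • x ∈ Metric.sphere (0 : V) 1 ∧
      Q x x = ‖x‖ ^ 2 * Q (‖x‖⁻¹ • x) (‖x‖⁻¹ • x) := by
    intro x hx
    have : ‖x‖ ≠ 0 := norm_ne_zero_iff.2 hx
    refine ⟨by simp [norm_smul, this], ?_⟩
    simp only [map_smul, LinearMap.smul_apply, smul_eq_mul]
    field_simp
  have hlow : ∀ x, ‖x‖ ^ 2 * Q a a ≤ Q x x := fun x => by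
    rcases eq_or_ne x 0 with rfl | hx
    · simp
    · rw [(hscale x hx).2]
      exact mul_le_mul_of_nonneg_left (hmin (hscale x hx).1) (by positivity)
  have hup : ∀ x, Q x x ≤ ‖x‖ ^ 2 * Q b b := fun x => by
    rcases eq_or_ne x 0 with rfl | hx
    · simp
    · rw [(hscale x hx).2]
      exact mul_le_mul_of_nonneg_left (hmax (hscale x hx).1) (by positivity)
  refine ⟨√(Q b b / Q a a), fun g => ContinuousLinearMap.opNorm_le_bound _ (by positivity)
    fun x => ?_⟩
  refine abs_le_of_sq_le_sq' ?_ (by positivity) |>.2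
  have hba : 0 ≤ Q b b / Q a a := div_nonneg (ha0.le.trans (hmin hb)) ha0.le
  rw [mul_pow, Real.sq_sqrt hba, div_mul_eq_mul_div, le_div_iff₀ ha0]
  calc _ ≤ Q (ρ g x) (ρ g x) := hlow _
    _ = Q x x := hpres g x
    _ ≤ _ := (hup x).trans_eq (mul_comm _ _)

end LorentzianForm

/-! ### Stabiliser of a null vector: boosts and rotational parts -/

section NullPair

variable {V : Type*} [NormedAddCommGroup V] [NormedSpace ℝ V]

/-- `n` and `n'` span a hyperbolic plane, in which they are lightlike with `ℓ(n,n') = 1`. -/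
structure IsNullPair (ℓ : LinearMap.BilinForm ℝ V) (n n' : V) : Prop where
  symm : ∀ x y, ℓ x y = ℓ y x
  left_null : ℓ n n = 0
  right_null : ℓ n' n' = 0
  pairing : ℓ n n' = 1

theorem IsLorentzianForm.exists_isNullPair {ℓ : LinearMap.BilinForm ℝ V} (hℓ : IsLorentzianForm ℓ)
    {n : V} (hn : n ≠ 0) (hnn : ℓ n n = 0) : ∃ n', IsNullPair ℓ n n' := by
  obtain ⟨w, hw⟩ : ∃ w, ℓ n w ≠ 0 := by
    by_contra! h
    exact hn (hℓ.eq_zero_of_forall h)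
  set u := (ℓ n w)⁻¹ • w with hu
  have hnu : ℓ n u = 1 := by simp [hu, hw]
  have hun : ℓ u n = 1 := by rw [hℓ.1, hnu]
  refine ⟨u - (ℓ u u / 2) • n, hℓ.1, hnn, ?_, ?_⟩
  · simp only [map_sub, map_smul, LinearMap.sub_apply, LinearMap.smul_apply, smul_eq_mul, hnu, hun,
      hnn]
    ring
  · simp only [map_sub, map_smul, smul_eq_mul, hnu, hnn]
    ring

theorem IsNullPair.pairing' {ℓ : LinearMap.BilinForm ℝ V} {n n' : V} (h : IsNullPair ℓ n n') :
    ℓ n' n = 1 := by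
  rw [h.symm, h.pairing]

theorem form_left_map {ℓ : LinearMap.BilinForm ℝ V} {n : V} {G : Type*} [Group G]
    (ρ : G →* (V →L[ℝ] V)) (hpres : ∀ g x y, ℓ (ρ g x) (ρ g y) = ℓ x y) (hfix : ∀ g, ρ g n = n)
    (g : G) (x : V) : ℓ n (ρ g x) = ℓ n x := by
  conv_lhs => rw [← hfix g]
  rw [hpres]

variable [FiniteDimensional ℝ V] (ℓ : LinearMap.BilinForm ℝ V) (n n' : V)

/-- The projection onto the orthogonal complement of the null pair `n`, `n'`. -/
noncomputable def nullProj : V →L[ℝ] V :=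
  1 - (LinearMap.toContinuousLinearMap (ℓ n')).smulRight n -
    (LinearMap.toContinuousLinearMap (ℓ n)).smulRight n'

/-- The Lorentz boost multiplying `n` by `t` and `n'` by `t⁻¹`. -/
noncomputable def nullBoost (t : ℝ) : V →L[ℝ] V :=
  nullProj ℓ n n' + t • (LinearMap.toContinuousLinearMap (ℓ n')).smulRight n +
    t⁻¹ • (LinearMap.toContinuousLinearMap (ℓ n)).smulRight n'

/-- The positive definite form obtained from `ℓ` by a change of sign on the orthogonal complement
of `n`, `n'`. -/
noncomputable def nullEuclideanForm : LinearMap.BilinForm ℝ V :=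
  (ℓ n).smulRight (ℓ n) + (ℓ n').smulRight (ℓ n') -
    ℓ.compl₁₂ (nullProj ℓ n n' : V →ₗ[ℝ] V) (nullProj ℓ n n' : V →ₗ[ℝ] V)

theorem nullProj_apply (x : V) : nullProj ℓ n n' x = x - ℓ n' x • n - ℓ n x • n' := rfl

theorem nullBoost_apply (t : ℝ) (x : V) :
    nullBoost ℓ n n' t x = nullProj ℓ n n' x + t • ℓ n' x • n + t⁻¹ • ℓ n x • n' := rfl

theorem nullEuclideanForm_apply (x y : V) : nullEuclideanForm ℓ n n' x y =
    ℓ n x * ℓ n y + ℓ n' x * ℓ n' y - ℓ (nullProj ℓ n n' x) (nullProj ℓ n n' y) := rfl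

variable {ℓ n n'}

namespace IsNullPair

variable (h : IsNullPair ℓ n n')
include h

theorem nullProj_left : nullProj ℓ n n' n = 0 := by
  rw [nullProj_apply, h.pairing', h.left_null]; simp

theorem nullProj_right : nullProj ℓ n n' n' = 0 := by
  rw [nullProj_apply, h.pairing, h.right_null]; simp

theorem form_left_nullProj (x : V) : ℓ n (nullProj ℓ n n' x) = 0 := by
  simp only [nullProj_apply, map_sub, map_smul, smul_eq_mul, h.left_null, h.pairing]; ring

theorem form_right_nullProj (x : V) : ℓ n' (nullProj ℓ n n' x) = 0 := by
  simp only [nullProj_apply, map_sub, map_smul, smul_eq_mul, h.right_null, h.pairing']; ring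

theorem nullProj_nullProj (x : V) : nullProj ℓ n n' (nullProj ℓ n n' x) = nullProj ℓ n n' x := by
  rw [nullProj_apply ℓ n n' (nullProj ℓ n n' x), h.form_left_nullProj, h.form_right_nullProj]
  simp

theorem form_nullProj_nullProj (x : V) (hx : ℓ n x = 0) (y : V) (hy : ℓ n y = 0) :
    ℓ (nullProj ℓ n n' x) (nullProj ℓ n n' y) = ℓ x y := by
  have hx' : ℓ x n = 0 := by rw [h.symm, hx]
  simp only [nullProj_apply, hx, hy, zero_smul, sub_zero, map_sub, map_smul, LinearMap.sub_apply,
    LinearMap.smul_apply, smul_eq_mul, h.left_null, hx']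
  ring

theorem nullBoost_left (t : ℝ) : nullBoost ℓ n n' t n = t • n := by
  rw [nullBoost_apply, h.nullProj_left, h.pairing', h.left_null]; simp

theorem nullBoost_right (t : ℝ) : nullBoost ℓ n n' t n' = t⁻¹ • n' := by
  rw [nullBoost_apply, h.nullProj_right, h.pairing, h.right_null]; simp

theorem nullBoost_nullProj (t : ℝ) (x : V) :
    nullBoost ℓ n n' t (nullProj ℓ n n' x) = nullProj ℓ n n' x := by
  rw [nullBoost_apply, h.nullProj_nullProj, h.form_left_nullProj, h.form_right_nullProj]; simp

theorem nullBoost_mul_nullBoost_inv {t : ℝ} (ht : t ≠ 0) :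
    nullBoost ℓ n n' t * nullBoost ℓ n n' t⁻¹ = 1 := by
  ext x
  change nullBoost ℓ n n' t (nullBoost ℓ n n' t⁻¹ x) = x
  rw [nullBoost_apply ℓ n n' t⁻¹, map_add, map_add, map_smul, map_smul, map_smul, map_smul,
    h.nullBoost_left, h.nullBoost_right, h.nullBoost_nullProj, nullProj_apply]
  rw [smul_comm (ℓ n' x) t, smul_comm (ℓ n x) t⁻¹, inv_inv, smul_smul t⁻¹ t, smul_smul t t⁻¹,
    inv_mul_cancel₀ ht, mul_inv_cancel₀ ht]
  module

/-- A non-spacelike vector orthogonal to `n` is a multiple of `n`, and orthogonality to `n'` then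
kills it; so `ℓ` is negative definite on the complement of the plane. -/
theorem nullEuclideanForm_pos (hℓ : IsLorentzianForm ℓ) (x : V) (hx : x ≠ 0) :
    0 < nullEuclideanForm ℓ n n' x x := by
  rw [nullEuclideanForm_apply]
  have hn : n ≠ 0 := by
    rintro rfl
    simpa using h.pairing
  by_cases hP : nullProj ℓ n n' x = 0
  · rw [hP]
    have hx' : x = ℓ n' x • n + ℓ n x • n' := by
      rw [nullProj_apply] at hP
      rw [← sub_eq_zero, ← hP]; abel
    simp only [map_zero, sub_zero]
    by_contra hle
    have h1 : ℓ n x = 0 := by nlinarith [mul_self_nonneg (ℓ n x), mul_self_nonneg (ℓ n' x)]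
    have h2 : ℓ n' x = 0 := by nlinarith [mul_self_nonneg (ℓ n x), mul_self_nonneg (ℓ n' x)]
    rw [h1, h2] at hx'
    exact hx (by simpa using hx')
  · have : ℓ (nullProj ℓ n n' x) (nullProj ℓ n n' x) < 0 := by
      by_contra hnot
      obtain ⟨s, hs⟩ := hℓ.exists_eq_smul hn h.left_null.ge (not_lt.1 hnot) (h.form_left_nullProj x)
      have h1 := h.form_right_nullProj x
      rw [hs, map_smul, h.pairing', smul_eq_mul, mul_one] at h1
      rw [h1, zero_smul] at hs
      exact hP hs
    nlinarith [mul_self_nonneg (ℓ n x), mul_self_nonneg (ℓ n' x)]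

end IsNullPair

variable {G : Type*} [Group G] (ρ : G →* (V →L[ℝ] V))

/-- On `n^⊥` the projection changes `x` only by a multiple of `n`, which `ρ g` fixes and the
projection kills. This lets the group act on `n^⊥/ℝn`, and makes `nullRotation` multiplicative. -/
theorem IsNullPair.nullProj_map_nullProj (h : IsNullPair ℓ n n') (hfix : ∀ g, ρ g n = n) {x : V}
    (hx : ℓ n x = 0) (g : G) :
    nullProj ℓ n n' (ρ g (nullProj ℓ n n' x)) = nullProj ℓ n n' (ρ g x) := by
  conv_lhs => rw [nullProj_apply ℓ n n' x, hx]
  simp [hfix, h.nullProj_left]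

section Fixed

variable (h : IsNullPair ℓ n n') (hpres : ∀ g x y, ℓ (ρ g x) (ρ g y) = ℓ x y)
  (hfix : ∀ g, ρ g n = n)
include h hpres hfix

/-- The rotational parts of a group of Lorentz transformations fixing the null vector `n`. -/
noncomputable def nullRotation : G →* (V →L[ℝ] V) where
  toFun g := nullProj ℓ n n' * ρ g * nullProj ℓ n n' + (1 - nullProj ℓ n n')
  map_one' := by
    ext x
    change nullProj ℓ n n' (ρ 1 (nullProj ℓ n n' x)) + (x - nullProj ℓ n n' x) = x
    rw [map_one]
    change nullProj ℓ n n' (nullProj ℓ n n' x) + (x - nullProj ℓ n n' x) = x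
    rw [h.nullProj_nullProj]; abel
  map_mul' a b := by
    ext x
    have h1 : ℓ n (ρ b (nullProj ℓ n n' x)) = 0 := by
      rw [form_left_map ρ hpres hfix, h.form_left_nullProj]
    change nullProj ℓ n n' (ρ (a * b) (nullProj ℓ n n' x)) + (x - nullProj ℓ n n' x) =
      nullProj ℓ n n' (ρ a (nullProj ℓ n n' (nullProj ℓ n n' (ρ b (nullProj ℓ n n' x)) +
        (x - nullProj ℓ n n' x)))) +
      ((nullProj ℓ n n' (ρ b (nullProj ℓ n n' x)) + (x - nullProj ℓ n n' x)) -
        nullProj ℓ n n' (nullProj ℓ n n' (ρ b (nullProj ℓ n n' x)) +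
        (x - nullProj ℓ n n' x)))
    simp only [map_add, map_sub, h.nullProj_nullProj, sub_self, add_zero, map_mul]
    rw [h.nullProj_map_nullProj ρ hfix h1]
    change nullProj ℓ n n' (ρ a (ρ b (nullProj ℓ n n' x))) + _ = _
    abel

theorem nullRotation_apply (g : G) (x : V) : nullRotation ρ h hpres hfix g x =
    nullProj ℓ n n' (ρ g (nullProj ℓ n n' x)) + (x - nullProj ℓ n n' x) := rfl

theorem nullEuclideanForm_nullRotation (g : G) (x y : V) :
    nullEuclideanForm ℓ n n' (nullRotation ρ h hpres hfix g x) (nullRotation ρ h hpres hfix g y) =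
      nullEuclideanForm ℓ n n' x y := by
  have h0 : ∀ x, ℓ n (ρ g (nullProj ℓ n n' x)) = 0 := fun x => by
    rw [form_left_map ρ hpres hfix, h.form_left_nullProj]
  have h1 : ∀ x, nullProj ℓ n n' (nullRotation ρ h hpres hfix g x) =
      nullProj ℓ n n' (ρ g (nullProj ℓ n n' x)) := fun x => by
    rw [nullRotation_apply, map_add, map_sub, h.nullProj_nullProj, h.nullProj_nullProj]; simp
  have h2 : ∀ x, ℓ n (nullRotation ρ h hpres hfix g x) = ℓ n x := fun x => by
    rw [nullRotation_apply, map_add, map_sub, h.form_left_nullProj, h.form_left_nullProj]; simp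
  have h3 : ∀ x, ℓ n' (nullRotation ρ h hpres hfix g x) = ℓ n' x := fun x => by
    rw [nullRotation_apply, map_add, map_sub, h.form_right_nullProj, h.form_right_nullProj]; simp
  rw [nullEuclideanForm_apply, nullEuclideanForm_apply, h1, h1, h2, h2, h3, h3,
    h.form_nullProj_nullProj _ (h0 x) _ (h0 y), hpres]

/-- Conjugation by boosts contracts a Lorentz transformation fixing `n` to its rotational part. -/
theorem tendsto_nullBoost_conj (g : G) :
    Tendsto (fun t : ℝ => nullBoost ℓ n n' t * ρ g * nullBoost ℓ n n' t⁻¹) (𝓝[≠] 0)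
      (𝓝 (nullRotation ρ h hpres hfix g)) := by
  -- For `t ≠ 0` the conjugate is exactly the rotational part plus `t • Y + t ^ 2 • Z`: `ρ g` is
  -- triangular for the flag `ℝn ⊂ n^⊥ ⊂ V`, and the boost scales its off-diagonal blocks.
  set Y : V →L[ℝ] V :=
    (LinearMap.toContinuousLinearMap (ℓ n') ∘L (ρ g * nullProj ℓ n n')).smulRight n +
      (LinearMap.toContinuousLinearMap (ℓ n)).smulRight (nullProj ℓ n n' (ρ g n'))
  set Z : V →L[ℝ] V :=
    (LinearMap.toContinuousLinearMap (ℓ n)).smulRight (ℓ n' (ρ g n') • n)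
  have hlim : Tendsto (fun t : ℝ => nullRotation ρ h hpres hfix g + t • Y + t ^ 2 • Z) (𝓝 0)
      (𝓝 (nullRotation ρ h hpres hfix g)) := by
    have : Continuous fun t : ℝ => nullRotation ρ h hpres hfix g + t • Y + t ^ 2 • Z := by fun_prop
    simpa using this.tendsto 0
  refine (hlim.mono_left nhdsWithin_le_nhds).congr' ?_
  filter_upwards [self_mem_nhdsWithin] with t ht
  have ht : t ≠ 0 := ht
  ext x
  change nullRotation ρ h hpres hfix g x + t • (ℓ n' (ρ g (nullProj ℓ n n' x)) • n +
      ℓ n x • nullProj ℓ n n' (ρ g n')) + t ^ 2 • (ℓ n x • ℓ n' (ρ g n') • n) =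
    nullBoost ℓ n n' t (ρ g (nullBoost ℓ n n' t⁻¹ x))
  have h1 : nullBoost ℓ n n' t (ρ g n') =
      nullProj ℓ n n' (ρ g n') + t • ℓ n' (ρ g n') • n + t⁻¹ • n' := by
    rw [nullBoost_apply, form_left_map ρ hpres hfix, h.pairing, one_smul]
  have h2 : nullBoost ℓ n n' t (ρ g (nullProj ℓ n n' x)) =
      nullProj ℓ n n' (ρ g (nullProj ℓ n n' x)) + t • ℓ n' (ρ g (nullProj ℓ n n' x)) • n := by
    rw [nullBoost_apply, form_left_map ρ hpres hfix, h.form_left_nullProj]; simp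
  have h3 : x - nullProj ℓ n n' x = ℓ n' x • n + ℓ n x • n' := by rw [nullProj_apply]; abel
  rw [nullBoost_apply ℓ n n' t⁻¹]
  simp only [map_add, map_smul, hfix, h1, h2, h.nullBoost_left, nullRotation_apply, h3, inv_inv]
  match_scalars <;> (field_simp; try ring)

/-- The commutator of two Lorentz transformations fixing `n` is trivial if their rotational parts
commute and they satisfy an Engel condition in both orders. -/
theorem map_commutator_eq_one_of_nullRotation (hℓ : IsLorentzianForm ℓ) {a b : G}
    (hab : nullRotation ρ h hpres hfix ⁅a, b⁆ = 1) {K K' : ℕ}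
    (hK : iteratedCommutator a b K = 1) (hK' : iteratedCommutator b a K' = 1) :
    ρ ⁅a, b⁆ = 1 := by
  -- The transverse part of `ρ g n'` is a cocycle over the rotations, and a positive definite form
  -- has no isotropic vectors.
  have hc : nullProj ℓ n n' (ρ ⁅a, b⁆ n') = 0 := by
    refine cocycle_commutator_eq_zero (ρ := nullRotation ρ h hpres hfix)
      (v := fun g => nullProj ℓ n n' (ρ g n')) (nullEuclideanForm ℓ n n')
      (nullEuclideanForm_nullRotation ρ h hpres hfix) (fun g k => ?_) (fun u _ hu => ?_) hab hK hK'
    · simp only [nullRotation_apply, h.nullProj_nullProj, sub_self, add_zero]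
      have h1 : ℓ n (ρ k n' - n') = 0 := by
        rw [map_sub, form_left_map ρ hpres hfix, sub_self]
      have h2 := h.nullProj_map_nullProj ρ hfix h1 g
      rw [map_sub, h.nullProj_right, sub_zero, map_sub, map_sub] at h2
      rw [h2, map_mul]
      change nullProj ℓ n n' (ρ g (ρ k n')) = _
      abel
    · by_contra hne
      exact (h.nullEuclideanForm_pos hℓ _ hne).ne' hu
  set c := ⁅a, b⁆
  have hn' : ρ c n' = n' := by
    have h1 : ρ c n' = ℓ n' (ρ c n') • n + n' := by
      rw [nullProj_apply, form_left_map ρ hpres hfix, h.pairing, one_smul] at hc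
      rw [← sub_eq_zero, ← hc]; abel
    have h2 := hpres c n' n'
    rw [h1] at h2
    simp only [map_add, map_smul, LinearMap.add_apply, LinearMap.smul_apply, smul_eq_mul,
      h.left_null, h.right_null, h.pairing, h.pairing'] at h2
    have h3 : ℓ n' (ρ c n') = 0 := by linarith
    rwa [h3, zero_smul, zero_add] at h1
  have hP : ∀ x, ρ c (nullProj ℓ n n' x) = nullProj ℓ n n' x := fun x => by
    have h1 : nullProj ℓ n n' (ρ c (nullProj ℓ n n' x)) = nullProj ℓ n n' x := by
      have := congrArg (fun T : V →L[ℝ] V => T (nullProj ℓ n n' x)) hab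
      simpa [nullRotation_apply, h.nullProj_nullProj] using this
    have h2 := hpres c n' (nullProj ℓ n n' x)
    rw [hn', h.form_right_nullProj] at h2
    rwa [nullProj_apply, form_left_map ρ hpres hfix, h.form_left_nullProj, h2, zero_smul,
      zero_smul, sub_zero, sub_zero] at h1
  ext x
  have h3 : x = nullProj ℓ n n' x + ℓ n' x • n + ℓ n x • n' := by rw [nullProj_apply]; abel
  conv_lhs => rw [h3]
  rw [map_add, map_add, map_smul, map_smul, hP, hn', hfix, ← h3]
  rfl

end Fixed

end NullPair

/-! ### Groups displacing every point in a spacelike direction -/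

section Group

variable {V : Type*} [NormedAddCommGroup V] [NormedSpace ℝ V] [FiniteDimensional ℝ V]
  {ℓ : LinearMap.BilinForm ℝ V} {G : Type*} [Group G] {ρ : G →* (V →L[ℝ] V)} {v : G → V}

/-- A discrete group of affine Lorentz transformations, which displaces every point in a spacelike
direction, is virtually abelian. -/
theorem isVirtuallyAbelian_of_spacelike_displacement (hℓ : IsLorentzianForm ℓ)
    (hpres : ∀ g x y, ℓ (ρ g x) (ρ g y) = ℓ x y)
    (hv : ∀ g h, v (g * h) = v g + ρ g (v h)) {r : ℝ} (hr : 0 < r)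
    (hdisc : ∀ g, ‖v g‖ < r → g = 1)
    (hspace : ∀ g, g ≠ 1 → ∀ x, ℓ (ρ g x + v g - x) (ρ g x + v g - x) < 0) :
    IsVirtuallyAbelian G := by
  have : Nontrivial V := by
    obtain ⟨e, he, -⟩ := hℓ.2
    exact ⟨e, 0, by rintro rfl; simp at he⟩
  have hiso : ∀ u, ρ u = 1 → ℓ (v u) (v u) = 0 → v u = 0 := by
    intro u hu h0
    by_cases hu1 : u = 1
    · rw [hu1, cocycle_one hv]
    · have := hspace u hu1 0
      simp [h0] at this
  have hpos : ∀ g u, ℓ u u ≤ ℓ (ρ g u) u := by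
    intro g u
    rcases eq_or_ne g 1 with rfl | hg
    · simp
    set d := ρ g u - u with hd
    -- The displacement at `s • u` is `s • d + v g`; as `s` grows, `ℓ d d > 0` would make it
    -- timelike.
    have hdd : ℓ d d ≤ 0 := by
      by_contra hlt
      rw [not_le] at hlt
      have hq : ∀ s : ℝ, s ^ 2 * ℓ d d + s * (ℓ d (v g) + ℓ (v g) d) + ℓ (v g) (v g) < 0 := by
        intro s
        have h1 := hspace g hg (s • u)
        have h2 : ρ g (s • u) + v g - s • u = s • d + v g := by
          rw [map_smul, hd, smul_sub]; abel
        rw [h2] at h1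
        simp only [map_add, map_smul, LinearMap.add_apply, LinearMap.smul_apply, smul_eq_mul] at h1
        linarith
      have hlim : Tendsto (fun s : ℝ => s * (s * ℓ d d + (ℓ d (v g) + ℓ (v g) d)) +
          ℓ (v g) (v g)) atTop atTop :=
        tendsto_atTop_add_const_right _ _ (tendsto_id.atTop_mul_atTop₀
          (tendsto_atTop_add_const_right _ _ (tendsto_id.atTop_mul_const hlt)))
      obtain ⟨s, hs⟩ := (hlim.eventually_ge_atTop 0).exists
      linarith [hq s]
    have h1 : ℓ u (ρ g u) = ℓ (ρ g u) u := hℓ.1 _ _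
    rw [hd] at hdd
    simp only [map_sub, LinearMap.sub_apply, hpres, h1] at hdd
    linarith
  by_cases hb : ∃ M : ℝ, ∀ g, ‖ρ g‖ ≤ M
  · obtain ⟨M, hM⟩ := hb
    set M' := max M 1
    have hM1 : 1 ≤ M' := le_max_right _ _
    have hM' : ∀ g, ‖ρ g‖ ≤ M' := fun g => (hM g).trans (le_max_left _ _)
    have hε : 0 < 1 / (16 * M' ^ 2) := by positivity
    have hle : 1 / (16 * M' ^ 2) ≤ 1 / 16 := by
      have := one_le_pow₀ (n := 2) hM1
      apply one_div_le_one_div_of_le <;> linarith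
    refine isVirtuallyAbelian_of_commute_near_one ρ hM' hε fun g h hg hh => ?_
    obtain ⟨K, hK⟩ := exists_iteratedCommutator_eq_one hv hr hdisc (hg.le.trans hle)
      (hh.le.trans hle)
    obtain ⟨K', hK'⟩ := exists_iteratedCommutator_eq_one hv hr hdisc (hh.le.trans hle)
      (hg.le.trans hle)
    have hgh := map_commutator_eq_one_of_iteratedCommutator_eq_one ρ hM1 hM' hg.le hh.le hK
    have h0 := cocycle_commutator_eq_zero ℓ hpres hv hiso hgh hK hK'
    exact commutatorElement_eq_one_iff_mul_comm.1 (hdisc _ (by rwa [h0, norm_zero]))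
  · push Not at hb
    obtain ⟨n, hn, hnn, hfix⟩ := exists_fixed_lightlike_vector hℓ hpres hpos hb
    obtain ⟨n', h⟩ := hℓ.exists_isNullPair hn hnn
    obtain ⟨M, hM⟩ := exists_norm_le_of_preserves_posDef (ρ := nullRotation ρ h hpres hfix)
      (nullEuclideanForm ℓ n n') (h.nullEuclideanForm_pos hℓ)
      (fun g x => nullEuclideanForm_nullRotation ρ h hpres hfix g x x)
    set M' := max M 1
    have hM1 : 1 ≤ M' := le_max_right _ _
    have hM' : ∀ g, ‖nullRotation ρ h hpres hfix g‖ ≤ M' := fun g => (hM g).trans (le_max_left _ _)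
    have hε : 0 < 1 / (16 * M' ^ 2) := by positivity
    have hle : 1 / (16 * M' ^ 2) ≤ 1 / 16 := by
      have := one_le_pow₀ (n := 2) hM1
      apply one_div_le_one_div_of_le <;> linarith
    refine isVirtuallyAbelian_of_commute_near_one _ hM' hε fun a b ha hb => ?_
    -- No boost need serve all elements: a single `t` for the given pair suffices, since the
    -- resulting Engel condition no longer mentions it.
    have hev : ∀ g, ‖nullRotation ρ h hpres hfix g - 1‖ < 1 / (16 * M' ^ 2) →
        ∀ᶠ t in 𝓝[≠] (0 : ℝ),
          ‖nullBoost ℓ n n' t * ρ g * nullBoost ℓ n n' t⁻¹ - 1‖ ≤ 1 / 16 := by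
      intro g hg
      have h1 := ((tendsto_nullBoost_conj ρ h hpres hfix g).sub_const 1).norm
      filter_upwards [h1.eventually (gt_mem_nhds (hg.trans_le hle))] with t ht using ht.le
    obtain ⟨t, ⟨hta, htb⟩, ht⟩ := (((hev a ha).and (hev b hb)).and self_mem_nhdsWithin).exists
    have ht : t ≠ 0 := ht
    have hD := h.nullBoost_mul_nullBoost_inv (inv_ne_zero ht)
    rw [inv_inv] at hD
    have hD' := h.nullBoost_mul_nullBoost_inv ht
    obtain ⟨K, hK⟩ := exists_iteratedCommutator_eq_one_of_conj hv hr hdisc hD hD' hta htb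
    obtain ⟨K', hK'⟩ := exists_iteratedCommutator_eq_one_of_conj hv hr hdisc hD hD' htb hta
    have hrot := map_commutator_eq_one_of_iteratedCommutator_eq_one
      (nullRotation ρ h hpres hfix) hM1 hM' ha.le hb.le hK
    have hab := map_commutator_eq_one_of_nullRotation ρ h hpres hfix hℓ hrot hK hK'
    have h0 := cocycle_commutator_eq_zero ℓ hpres hv hiso hab hK hK'
    exact commutatorElement_eq_one_iff_mul_comm.1 (hdisc _ (by rwa [h0, norm_zero]))

end Group

/-! ### Causality and deck transformations -/

section DeckTransformations

variable {V : Type*} [NormedAddCommGroup V] [NormedSpace ℝ V] [FiniteDimensional ℝ V]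
  {Γ : Subgroup (V ≃ᵃ[ℝ] V)}

theorem continuousConstSMul_affineSubgroup (Γ : Subgroup (V ≃ᵃ[ℝ] V)) : ContinuousConstSMul Γ V :=
  ⟨fun γ => AffineMap.continuous_of_finiteDimensional (γ.1 : V →ᵃ[ℝ] V)⟩

/-- In a causal quotient, no deck transformation moves a point into its future. -/
theorem IsCausal.apply_eq_of_sub_mem {C : Set V} (hM : IsCausal C Γ)
    (hproper : ProperlyDiscontinuousSMul Γ V) {γ : V ≃ᵃ[ℝ] V} (hγ : γ ∈ Γ) {v : V}
    (hc : γ v - v ∈ C) : γ v = v := by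
  set c := γ v - v with hcdef
  by_contra hne
  have hc0 : c ≠ 0 := sub_ne_zero.2 hne
  let η : Path (FlatQuotient.proj Γ v) (FlatQuotient.proj Γ v) :=
    { toFun := fun t => FlatQuotient.proj Γ (v + (t : ℝ) • c)
      continuous_toFun := continuous_quotient_mk'.comp (by fun_prop)
      source' := by simp
      target' := by
        refine Quotient.sound ⟨⟨γ, hγ⟩, ?_⟩
        change γ v = v + (1 : ℝ) • c
        simp [hcdef] }
  have hη : IsPiecewiseSmoothTimelike C Γ η := by
    refine ⟨1, fun i => i, by simp, by simp, fun i hi => ?_⟩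
    obtain rfl : i = 0 := by omega
    refine ⟨by simp, fun t _ => ⟨fun s => v + s • c, ?_⟩⟩
    simp only [Nat.cast_zero, zero_add, Nat.cast_one]
    filter_upwards [self_mem_nhdsWithin] with s hs
    refine ⟨(η.extend_apply hs).symm, ContDiff.contDiffWithinAt (by fun_prop), ?_⟩
    have h1 : HasDerivAt (fun s : ℝ => v + s • c) c s := by
      simpa using ((hasDerivAt_id s).smul_const c).const_add v
    rw [h1.hasDerivWithinAt.derivWithin (uniqueDiffOn_Icc zero_lt_one s hs)]
    exact hc
  have hconst := hM _ η hη
  have := continuousConstSMul_affineSubgroup Γ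
  -- The projected segment must be seen to be nonconstant: a constant one would put points `v + t •
  -- c` arbitrarily near `v` in its orbit.
  obtain ⟨U, hU, hU'⟩ := ProperlyDiscontinuousSMul.exists_nhds_image_smul_eq_self Γ v
  have hlim : Tendsto (fun t : ℝ => v + t • c) (𝓝[>] 0) (𝓝 v) := by
    have : Continuous fun t : ℝ => v + t • c := by fun_prop
    simpa using (this.tendsto 0).mono_left nhdsWithin_le_nhds
  obtain ⟨t, ht, ht0, ht1⟩ := ((hlim.eventually_mem hU).and
    (Ioo_mem_nhdsGT (zero_lt_one (α := ℝ)))).exists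
  obtain ⟨δ, hδ⟩ := Quotient.exact (hconst ⟨t, ht0.le, ht1.le⟩)
  have hδ : δ • v = v + t • c := hδ
  have hfix := hU' δ ⟨δ • v, ⟨v, mem_of_mem_nhds hU, rfl⟩, by rwa [hδ]⟩
  rw [hδ, add_eq_left] at hfix
  exact (smul_ne_zero ht0.ne' hc0) hfix

/-- In a causal quotient, nontrivial deck transformations displace every point in a spacelike
direction. -/
theorem IsCausal.form_displacement_neg {ℓ : LinearMap.BilinForm ℝ V} {e : V}
    (hΓ : ActsByLorentzianDeckTransformations ℓ (lightCone ℓ e) Γ)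
    (hM : IsCausal (lightCone ℓ e) Γ) {γ : V ≃ᵃ[ℝ] V} (hγ : γ ∈ Γ) (hγ1 : γ ≠ 1) (v : V) :
    ℓ (γ v - v) (γ v - v) < 0 := by
  by_contra hnot
  rw [not_lt] at hnot
  refine hγ1 (hΓ.free γ hγ v ?_)
  rcases le_total 0 (ℓ e (γ v - v)) with h | h
  · exact hM.apply_eq_of_sub_mem hΓ.proper hγ ⟨hnot, h⟩
  -- When `γ` moves `v` into its past, `γ⁻¹` moves `γ v` into its future.
  · have hinv : γ⁻¹ (γ v) = v := AffineEquiv.symm_apply_apply γ v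
    have h1 : γ⁻¹ (γ v) - γ v ∈ lightCone ℓ e := by
      rw [hinv, ← neg_sub]
      refine ⟨by rwa [map_neg, map_neg, LinearMap.neg_apply, neg_neg], ?_⟩
      rw [map_neg]
      linarith
    have h2 := hM.apply_eq_of_sub_mem hΓ.proper (Γ.inv_mem hγ) h1
    rw [hinv] at h2
    exact h2.symm

/-- The representation of a group of affine transformations by their linear parts. -/
noncomputable def linearPartHom (Γ : Subgroup (V ≃ᵃ[ℝ] V)) : Γ →* (V →L[ℝ] V) where
  toFun γ := LinearMap.toContinuousLinearMap (γ.1.linear : V →ₗ[ℝ] V)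
  map_one' := rfl
  map_mul' _ _ := rfl

theorem linearPartHom_apply_add (γ : Γ) (x : V) : linearPartHom Γ γ x + γ.1 0 = γ.1 x := by
  have h1 : γ.1 (x + 0) = linearPartHom Γ γ x + γ.1 0 := γ.1.map_vadd 0 x
  rw [← h1, add_zero]

theorem isVirtuallyAbelian_of_isCausal {ℓ : LinearMap.BilinForm ℝ V} (hℓ : IsLorentzianForm ℓ)
    {e : V} (hΓ : ActsByLorentzianDeckTransformations ℓ (lightCone ℓ e) Γ)
    (hM : IsCausal (lightCone ℓ e) Γ) : IsVirtuallyAbelian Γ := by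
  have := continuousConstSMul_affineSubgroup Γ
  have := hΓ.proper
  obtain ⟨U, hU, hU'⟩ := ProperlyDiscontinuousSMul.exists_nhds_image_smul_eq_self Γ (0 : V)
  obtain ⟨r, hr, hball⟩ := Metric.mem_nhds_iff.1 hU
  refine isVirtuallyAbelian_of_spacelike_displacement (ρ := linearPartHom Γ)
    (v := fun γ => γ.1 0) hℓ (fun γ x y => hΓ.preserves_form γ.1 γ.2 x y) (fun γ δ => ?_) hr
    (fun γ hγ => ?_) (fun γ hγ x => ?_)
  · rw [add_comm, linearPartHom_apply_add]
    rfl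
  · have h0 : γ • (0 : V) = 0 := hU' γ ⟨γ • 0, ⟨0, mem_of_mem_nhds hU, rfl⟩, hball
      (mem_ball_zero_iff.2 hγ)⟩
    exact Subtype.ext (hΓ.free γ.1 γ.2 0 h0)
  · rw [linearPartHom_apply_add]
    exact hM.form_displacement_neg hΓ γ.2 (fun h => hγ (Subtype.ext h)) x

end DeckTransformations

theorem mainTheorem1 {V : Type*} [NormedAddCommGroup V] [NormedSpace ℝ V] [FiniteDimensional ℝ V]
    (ℓ : LinearMap.BilinForm ℝ V) (hℓ : IsLorentzianForm ℓ)
    (e : V) (he : 0 < ℓ e e)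
    (Γ : Subgroup (V ≃ᵃ[ℝ] V))
    (hΓ : ActsByLorentzianDeckTransformations ℓ (lightCone ℓ e) Γ)
    (hM : IsStrictlyCausal (lightCone ℓ e) Γ) (p : FlatQuotient Γ) :
    IsVirtuallyAbelian (FundamentalGroup (FlatQuotient Γ) p) := by
  have := continuousConstSMul_affineSubgroup Γ
  have := hΓ.proper
  have : IsCancelSMul Γ V := isCancelSMul_iff_eq_one_of_smul_eq.2 fun γ v h =>
    Subtype.ext (hΓ.free γ.1 γ.2 v h)
  have : ProperSpace V := FiniteDimensional.proper ℝ V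
  have hcov : IsQuotientCoveringMap (Quotient.mk (MulAction.orbitRel Γ V)) Γ :=
    isQuotientCoveringMap_quotientMk_of_properlyDiscontinuousSMul
  obtain ⟨v, hv⟩ := Quotient.exists_rep p
  -- Since `V` is simply connected, the covering identifies the fundamental group with the opposite
  -- of `Γ`; inversion removes the opposite.
  exact (isVirtuallyAbelian_of_isCausal hℓ hΓ hM.1).of_mulEquiv
    ((hcov.fundamentalGroupEquiv ⟨v, hv⟩).trans (MulEquiv.inv' Γ).symm)
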